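/- Let $G$ be a (discrete) group. Actions of $G$ are right actions, and an action on a topological space is continuous if every $g\in G$ acts by a continuous map. Then the following are equivalent: 1. There is a right-invariant finitely additive probability measure on $G$, i.e. a map $\mu\colon\mathcal P(G)\to[0,1]$ with $\mu(G)=1$, $\mu(X\cup Y)=\mu(X)+\mu(Y)$ for all disjoint $X,Y\subseteq G$, and $\mu(Xg)=\mu(X)$ for all $X\subseteq G$, $g\in G$. 2. There is a right-invariant mean on $G$, i.e. a linear map $m\colon\ell^\infty_{\mathbb R}(G)\to\mathbb R$ with $m(1)=1$, $m(x)\ge 0$ whenever $x\ge 0$, and $m(x^g)=m(x)$ for all $x\in\ell^\infty_{\mathbb R}(G)$, $g\in G$, where $x^g(h)=x(hg^{-1})$. 3. $G$ satisfies the Følner condition: for every finite $X\subseteq G$ and every $\varepsilon>0$ there is a finite non-empty $F\subseteq G$ with $|F\setminus Fg|/|F|<\varepsilon$ for all $g\in X$. 4. There is a Følner net in $G$, i.e. a family $(F_i)_{i\in I}$ of finite non-empty subsets of $G$ indexed by a non-empty directed partially ordered set $I$ such that $\lim_{i\in I}|F_i\setminus F_ig|/|F_i|=0$ for every $g\in G$.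 5. $G$ is non-paradoxical: there do not exist subsets $X_1,\dots,X_n,Y_1,\dots,Y_m$ of $G$ and elements $g_1,\dots,g_n,h_1,\dots,h_m$ of $G$ such that $G$ is the disjoint union of $X_1,\dots,X_n,Y_1,\dots,Y_m$, is the disjoint union of $X_1g_1,\dots,X_ng_n$, and is the disjoint union of $Y_1h_1,\dots,Y_mh_m$. 6. Every affine continuous action of $G$ on a non-empty convex compact subset of a Hausdorff (real) topological vector space has a fixed point. 7. Every continuous action of $G$ on a non-empty compact Hausdorff topological space has an invariant Borel probability measure. -/

import Mathlib

universe u v w z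

namespace AmenableGroup

open scoped Pointwise ENNReal Topology RightActions
open MeasureTheory Filter

/-! Throughout, a right action of a group `G` on `Ω` is a `MulAction Gᵐᵒᵖ Ω`, and `ω <• g`
(resp. `X <• g`) is the point `ω g` (resp. the set `X g`).  The group `G` carries the discrete
topology, so an action of `G` is continuous if and only if each of its elements acts continuously,
i.e. `ContinuousConstSMul Gᵐᵒᵖ Ω`. -/

/-- A finitely additive probability measure on `G`, defined on all subsets of `G`. -/
structure FinAddProbMeasure (G : Type u) where
  toFun : Set G → ℝ
  mem_Icc : ∀ X : Set G, toFun X ∈ Set.Icc (0 : ℝ) 1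
  univ : toFun Set.univ = 1
  union : ∀ X Y : Set G, Disjoint X Y → toFun (X ∪ Y) = toFun X + toFun Y

/-- `μ (X g) = μ X` for all `X ⊆ G` and `g ∈ G`. -/
def FinAddProbMeasure.IsRightInvariant {G : Type u} [Group G] (μ : FinAddProbMeasure G) : Prop :=
  ∀ (X : Set G) (g : G), μ.toFun (X <• g) = μ.toFun X

/-- The Banach space of bounded real functions on `Ω`. -/
abbrev EllInfty (Ω : Type u) : Type u := lp (fun _ : Ω => ℝ) ∞

/-- The function `x ^ g`, given by `x ^ g (h) = x (h g⁻¹)`. -/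
def EllInfty.translate {G : Type u} [Group G] (x : EllInfty G) (g : G) : EllInfty G :=
  ⟨fun h => x (h * g⁻¹), memℓp_infty (by
    obtain ⟨C, hC⟩ := memℓp_infty_iff.1 (lp.memℓp x)
    exact ⟨C, by rintro _ ⟨h, rfl⟩; exact hC ⟨h * g⁻¹, rfl⟩⟩)⟩

/-- A mean on `G`: a normalised positive linear functional on the bounded functions. -/
structure Mean (G : Type u) where
  toLinearMap : EllInfty G →ₗ[ℝ] ℝ
  map_one : toLinearMap 1 = 1
  nonneg : ∀ x : EllInfty G, (∀ h : G, 0 ≤ x h) → 0 ≤ toLinearMap x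

/-- `m (x ^ g) = m x` for all bounded `x` and all `g ∈ G`. -/
def Mean.IsRightInvariant {G : Type u} [Group G] (m : Mean G) : Prop :=
  ∀ (x : EllInfty G) (g : G), m.toLinearMap (x.translate g) = m.toLinearMap x

open scoped Classical in
/-- The number `|F \ F g| / |F|`. -/
noncomputable def folnerRatio {G : Type u} [Group G] (F : Finset G) (g : G) : ℝ :=
  ((F \ (F <• g)).card : ℝ) / (F.card : ℝ)

/-- The Følner condition. -/
def FolnerCondition (G : Type u) [Group G] : Prop :=
  ∀ (X : Finset G) (ε : ℝ), 0 < ε →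
    ∃ F : Finset G, F.Nonempty ∧ ∀ g ∈ X, folnerRatio F g < ε

/-- `F` is a Følner net indexed by the (nonempty) directed set `I`. -/
structure IsFolnerNet {G : Type u} [Group G] {I : Type v} [PartialOrder I] [IsDirectedOrder I]
    [Nonempty I] (F : I → Finset G) : Prop where
  nonempty : ∀ i, (F i).Nonempty
  tendsto : ∀ g : G, Tendsto (fun i => folnerRatio (F i) g) atTop (𝓝 0)

/-- There is a Følner net in `G`. -/
def HasFolnerNet.{u', v'} (G : Type u') [Group G] : Prop :=
  ∃ (I : Type (max u' v')) (_ : PartialOrder I) (_ : IsDirectedOrder I) (_ : Nonempty I)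
    (F : I → Finset G), IsFolnerNet F

/-- A right action of `G` on a set `Ω` is paradoxical: `Ω` is the disjoint union of
`X₁, …, Xₙ, Y₁, …, Yₘ`, the disjoint union of the `Xᵢ gᵢ`, and the disjoint union of the
`Yⱼ hⱼ`. -/
def IsParadoxicalAction (G : Type u) [Group G] (Ω : Type v) [MulAction Gᵐᵒᵖ Ω] : Prop :=
  ∃ (n m : ℕ) (X : Fin n → Set Ω) (Y : Fin m → Set Ω) (g : Fin n → G) (h : Fin m → G),
    (Pairwise fun i j => Disjoint (X i) (X j)) ∧
    (Pairwise fun i j => Disjoint (Y i) (Y j)) ∧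
    (∀ i j, Disjoint (X i) (Y j)) ∧
    (⋃ i, X i) ∪ (⋃ j, Y j) = Set.univ ∧
    (Pairwise fun i j => Disjoint (X i <• g i) (X j <• g j)) ∧
    (⋃ i, X i <• g i) = Set.univ ∧
    (Pairwise fun i j => Disjoint (Y i <• h i) (Y j <• h j)) ∧
    (⋃ j, Y j <• h j) = Set.univ

/-- `G` is paradoxical: its action on itself by right multiplication is paradoxical. -/
def IsParadoxical (G : Type u) [Group G] : Prop := IsParadoxicalAction G G

/-- The right action of `G` on the subset `C` of a real vector space is affine: every `g ∈ G`
preserves the convex combinations that lie in `C`. -/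
def IsAffineAction (G : Type u) [Group G] {E : Type v} [AddCommGroup E] [Module ℝ E] (C : Set E)
    [MulAction Gᵐᵒᵖ C] : Prop :=
  ∀ (g : G) (x y p : C) (a b : ℝ), 0 ≤ a → 0 ≤ b → a + b = 1 →
    (p : E) = a • (x : E) + b • (y : E) →
    ((p <• g : C) : E) = a • ((x <• g : C) : E) + b • ((y <• g : C) : E)

/-- Every affine continuous action of `G` on a nonempty convex compact subset of a Hausdorff
topological vector space has a fixed point. -/
def HasFixedPointProperty.{u', v'} (G : Type u') [Group G] : Prop :=
  ∀ (E : Type (max u' v')) [AddCommGroup E] [Module ℝ E] [TopologicalSpace E]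
    [IsTopologicalAddGroup E] [ContinuousSMul ℝ E] [T2Space E] (C : Set E),
    C.Nonempty → Convex ℝ C → IsCompact C →
    ∀ [MulAction Gᵐᵒᵖ C] [ContinuousConstSMul Gᵐᵒᵖ C], IsAffineAction G C →
      ∃ c : C, ∀ g : G, c <• g = c

/-- Every continuous action of `G` on a nonempty compact Hausdorff space has an invariant Borel
probability measure. -/
def HasInvariantMeasureProperty.{u', v'} (G : Type u') [Group G] : Prop :=
  ∀ (Ω : Type (max u' v')) [TopologicalSpace Ω] [CompactSpace Ω] [T2Space Ω] [Nonempty Ω]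
    [MeasurableSpace Ω] [BorelSpace Ω] [MulAction Gᵐᵒᵖ Ω] [ContinuousConstSMul Gᵐᵒᵖ Ω],
    ∃ μ : Measure Ω, IsProbabilityMeasure μ ∧
      ∀ (g : G) (A : Set Ω), MeasurableSet A → μ (A <• g) = μ A

end AmenableGroup

/-!
The conditions imply each other along the cycle 1 → 5 → 3 → 4 → 6 → 2 → 7 → 1.

* 1 → 5: both families of a paradoxical decomposition have total mass one before translation.
* 5 → 3: if the Følner condition fails, some finite set `S` satisfies `c |F| ≤ |F S|` for all finite
  `F` and a constant `c > 1`, so a power `K` of `S` satisfies `2 |F| ≤ |F K|`. By Hall's theorem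
  there are two injections `G → G` with disjoint ranges which move every `x` to a point of `x K`;
  they are piecewise translations, and the Schröder–Bernstein argument turns them into a
  paradoxical decomposition.
* 4 → 6: the averages of an orbit over the sets of a Følner net are asymptotically invariant, and
  the limits of such averages are fixed points.
* 6 → 2: the means form a compact convex set in the topology of pointwise convergence.
* 2 → 7: by the Riesz–Markov–Kakutani theorem, the image of an invariant mean under an orbit map is
  a measure.
* 7 → 1: an invariant measure on the Stone–Čech compactification of `G` restricts to an invariant
  finitely additive measure on the clopen sets, which are the subsets of `G`.
-/

namespace AmenableGroup

open scoped Pointwise ENNReal Topology RightActions CompactlySupported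
open MeasureTheory Filter Topology

section FiniteAdditivity

theorem FinAddProbMeasure.empty {Ω : Type u} (μ : FinAddProbMeasure Ω) : μ.toFun ∅ = 0 := by
  simpa using μ.union ∅ ∅ (by simp)

theorem FinAddProbMeasure.iUnion {Ω : Type u} (μ : FinAddProbMeasure Ω) {ι : Type*} [Fintype ι]
    {X : ι → Set Ω} (hX : Pairwise fun i j => Disjoint (X i) (X j)) :
    μ.toFun (⋃ i, X i) = ∑ i, μ.toFun (X i) := by
  classical
  have biUnion (s : Finset ι) : μ.toFun (⋃ i ∈ s, X i) = ∑ i ∈ s, μ.toFun (X i) := by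
    induction s using Finset.induction_on with
    | empty => simp [μ.empty]
    | insert a s ha ih =>
      rw [Finset.set_biUnion_insert, μ.union, ih, Finset.sum_insert ha]
      exact Set.disjoint_iUnion₂_right.2 fun i hi => hX (ne_of_mem_of_not_mem hi ha).symm
  simpa using biUnion Finset.univ

theorem FinAddProbMeasure.not_isParadoxicalAction {G : Type u} [Group G] {Ω : Type v}
    [MulAction Gᵐᵒᵖ Ω] (μ : FinAddProbMeasure Ω)
    (hμ : ∀ (X : Set Ω) (g : G), μ.toFun (X <• g) = μ.toFun X) : ¬ IsParadoxicalAction G Ω := by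
  rintro ⟨n, m, X, Y, g, h, hX, hY, hXY, hcover, hXg, hXg_univ, hYh, hYh_univ⟩
  have hX_mass : ∑ i, μ.toFun (X i) = 1 := by
    simpa only [hXg_univ, μ.univ, hμ] using (μ.iUnion hXg).symm
  have hY_mass : ∑ j, μ.toFun (Y j) = 1 := by
    simpa only [hYh_univ, μ.univ, hμ] using (μ.iUnion hYh).symm
  have htotal := μ.union _ _
    (Set.disjoint_iUnion_left.2 fun i => Set.disjoint_iUnion_right.2 (hXY i))
  rw [hcover, μ.univ, μ.iUnion hX, μ.iUnion hY, hX_mass, hY_mass] at htotal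
  norm_num at htotal

end FiniteAdditivity

section Equidecompositions

variable {H Ω : Type*}

theorem exists_equidecomp_of_injOn [SMul H Ω] {f : Ω → Ω} {A : Set Ω} {S : Finset H}
    (hf : A.InjOn f) (hS : Equidecomp.IsDecompOn f A S) :
    ∃ e : Equidecomp Ω H, e.source = A ∧ e.target = f '' A := by
  rcases isEmpty_or_nonempty Ω with _ | _
  · exact ⟨⟨.refl Ω, ∅, fun x => isEmptyElim x⟩, Subsingleton.elim _ _, Subsingleton.elim _ _⟩
  · exact ⟨⟨hf.toPartialEquiv, S, hS⟩, rfl, rfl⟩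

theorem exists_partition_of_equidecomp [SMul H Ω] (e : Equidecomp Ω H) :
    ∃ (n : ℕ) (X : Fin n → Set Ω) (g : Fin n → H),
      (Pairwise fun i j => Disjoint (X i) (X j)) ∧ ⋃ i, X i = e.source ∧
      (Pairwise fun i j => Disjoint (g i • X i) (g j • X j)) ∧ ⋃ i, g i • X i = e.target := by
  choose γ hγ hγe using e.isDecompOn
  let g (i : Fin e.witness.card) : H := e.witness.equivFin.symm i
  let X (i : Fin e.witness.card) : Set Ω := {x | ∃ hx : x ∈ e.source, γ x hx = g i}
  have hX : Pairwise fun i j => Disjoint (X i) (X j) := fun i j hij =>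
    Set.disjoint_left.2 fun x ⟨_, hi⟩ ⟨_, hj⟩ =>
      hij (e.witness.equivFin.symm.injective (Subtype.ext (hi.symm.trans hj)))
  have hX_union : ⋃ i, X i = e.source := by
    refine Set.Subset.antisymm (Set.iUnion_subset fun i x ⟨hx, _⟩ => hx) fun x hx => ?_
    exact Set.mem_iUnion.2 ⟨e.witness.equivFin ⟨γ x hx, hγ x hx⟩, hx, by simp [g]⟩
  have hgX (i) : g i • X i = e '' X i :=
    Set.image_congr fun x ⟨hx, hxi⟩ => by rw [hγe x hx, hxi]
  refine ⟨_, X, g, hX, hX_union, fun i j hij => ?_, ?_⟩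
  · simp only [hgX]
    exact Set.disjoint_image_image fun x hx y hy hxy =>
      (hX hij).ne_of_mem hx hy (e.injOn hx.1 hy.1 hxy)
  · simp only [hgX]
    rw [← Set.image_iUnion, hX_union, e.image_source_eq_target]

theorem exists_equidecomp_of_mutual_embedding [Group H] [MulAction H Ω] {A B : Set Ω}
    (e e' : Equidecomp Ω H) (he : e.source = A) (heB : e.target ⊆ B) (he' : e'.source = B)
    (heA : e'.target ⊆ A) : ∃ d : Equidecomp Ω H, d.source = A ∧ d.target = B := by
  classical
  subst he he'
  obtain ⟨h, hbij, hrel⟩ := Function.Embedding.schroeder_bernstein_of_rel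
    (f := fun x : e.source => (⟨e x, heB (e.map_source x.2)⟩ : e'.source))
    (g := fun y : e'.source => (⟨e' y, heA (e'.map_source y.2)⟩ : e.source))
    (fun x y hxy => Subtype.ext (e.injOn x.2 y.2 (congrArg Subtype.val hxy)))
    (fun x y hxy => Subtype.ext (e'.injOn x.2 y.2 (congrArg Subtype.val hxy)))
    (fun x y => ∃ k ∈ e.witness ∪ e'.witness⁻¹, (y : Ω) = k • (x : Ω))
    (fun x => by
      obtain ⟨k, hk, hkx⟩ := e.isDecompOn x x.2
      exact ⟨k, Finset.mem_union_left _ hk, hkx⟩)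
    (fun y => by
      obtain ⟨k, hk, hky⟩ := e'.isDecompOn y y.2
      exact ⟨k⁻¹, Finset.mem_union_right _ (Finset.inv_mem_inv hk), by simp [hky]⟩)
  let f : Ω → Ω := Function.extend Subtype.val (Subtype.val ∘ h) id
  have hf (x : e.source) : f x = h x := Subtype.val_injective.extend_apply _ _ x
  have hf_inj : e.source.InjOn f := fun x hx y hy hxy => by
    rw [hf ⟨x, hx⟩, hf ⟨y, hy⟩] at hxy
    exact congrArg Subtype.val (hbij.1 (Subtype.ext hxy))
  have hf_image : f '' e.source = e'.source := by
    rw [Set.image_eq_range]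
    simp only [hf]
    rw [Set.range_comp' Subtype.val h, hbij.2.range_eq, Set.image_univ, Subtype.range_val]
  obtain ⟨d, hd, hd'⟩ := exists_equidecomp_of_injOn hf_inj
    (S := e.witness ∪ e'.witness⁻¹) fun x hx => by simpa only [hf ⟨x, hx⟩] using hrel ⟨x, hx⟩
  exact ⟨d, hd, hd'.trans hf_image⟩

theorem isParadoxicalAction_of_disjoint_targets {G : Type u} [Group G] {Ω : Type v}
    [MulAction Gᵐᵒᵖ Ω] (e e' : Equidecomp Ω Gᵐᵒᵖ) (he : e.source = Set.univ)
    (he' : e'.source = Set.univ) (hdisj : Disjoint e.target e'.target) :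
    IsParadoxicalAction G Ω := by
  obtain ⟨d, hd, hd'⟩ := exists_equidecomp_of_mutual_embedding e'
    ((Equidecomp.refl Ω Gᵐᵒᵖ).restr e.targetᶜ) he' hdisj.subset_compl_left
    (Equidecomp.source_restr _ (Set.subset_univ _)) (Set.subset_univ _)
  obtain ⟨n, X, g, hX, hX_union, hXg, hXg_union⟩ := exists_partition_of_equidecomp e.symm
  obtain ⟨m, Y, h, hY, hY_union, hYh, hYh_union⟩ := exists_partition_of_equidecomp d.symm
  have hX_target : ⋃ i, X i = e.target := hX_union
  have hY_target : ⋃ j, Y j = e.targetᶜ := hY_union.trans hd'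
  refine ⟨n, m, X, Y, fun i => (g i).unop, fun j => (h j).unop, hX, hY, fun i j => ?_, ?_,
    hXg, hXg_union.trans he, hYh, hYh_union.trans hd⟩
  · refine Disjoint.mono (Set.subset_iUnion X i) (Set.subset_iUnion Y j) ?_
    rw [hX_target, hY_target]
    exact disjoint_compl_right
  · rw [hX_target, hY_target, Set.union_compl_self]

end Equidecompositions

section Doubling

open Finset

theorem exists_disjoint_injective_selections {α β : Type*} [DecidableEq β] (t : α → Finset β)
    (ht : ∀ s : Finset α, 2 * #s ≤ #(s.biUnion t)) :
    ∃ f f' : α → β, f.Injective ∧ f'.Injective ∧ Disjoint (Set.range f) (Set.range f') ∧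
      (∀ a, f a ∈ t a) ∧ ∀ a, f' a ∈ t a := by
  classical
  obtain ⟨φ, hφ, hmem⟩ := (all_card_le_biUnion_card_iff_exists_injective
    fun x : α × Bool => t x.1).1 fun s => calc
      #s ≤ #(s.image Prod.fst ×ˢ (univ : Finset Bool)) :=
        card_le_card fun x hx => mem_product.2 ⟨mem_image_of_mem _ hx, mem_univ _⟩
      _ = 2 * #(s.image Prod.fst) := by rw [card_product, mul_comm, card_univ, Fintype.card_bool]
      _ ≤ #((s.image Prod.fst).biUnion t) := ht _
      _ = #(s.biUnion fun x => t x.1) := by rw [image_biUnion]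
  have hφ_ne (a b : α) : φ (a, true) ≠ φ (b, false) := hφ.ne (by simp)
  exact ⟨fun a => φ (a, true), fun a => φ (a, false),
    fun a b hab => congrArg Prod.fst (hφ hab), fun a b hab => congrArg Prod.fst (hφ hab),
    Set.disjoint_range_iff.2 hφ_ne, fun a => hmem _, fun a => hmem _⟩

theorem isParadoxical_of_forall_two_mul_card_le {G : Type u} [Group G] [DecidableEq G]
    {K : Finset G} (hK : ∀ F : Finset G, 2 * #F ≤ #(F * K)) : IsParadoxical G := by
  obtain ⟨f, f', hf, hf', hdisj, hmem, hmem'⟩ :=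
    exists_disjoint_injective_selections (fun x : G => x • K) fun F => by
      simpa only [biUnion_smul_finset, smul_eq_mul] using hK F
  have hdecomp {φ : G → G} (hφ : ∀ x, φ x ∈ x • K) :
      Equidecomp.IsDecompOn φ Set.univ (K.map MulOpposite.opEquiv.toEmbedding) := fun x _ => by
    obtain ⟨k, hk, hkx⟩ := mem_smul_finset.1 (hφ x)
    exact ⟨.op k, mem_map_of_mem _ hk, hkx.symm⟩
  obtain ⟨e, he, he_target⟩ := exists_equidecomp_of_injOn hf.injOn (hdecomp hmem)
  obtain ⟨e', he', he_target'⟩ := exists_equidecomp_of_injOn hf'.injOn (hdecomp hmem')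
  refine isParadoxicalAction_of_disjoint_targets e e' he he' ?_
  rwa [he_target, he_target', Set.image_univ, Set.image_univ]

theorem pow_mul_card_le_card_mul_pow {M R : Type*} [Monoid M] [DecidableEq M] [CommSemiring R]
    [PartialOrder R] [IsOrderedRing R] {S : Finset M} {c : R} (hc : 0 ≤ c)
    (hS : ∀ F : Finset M, c * #F ≤ #(F * S)) (n : ℕ) (F : Finset M) :
    c ^ n * #F ≤ #(F * S ^ n) := by
  induction n with
  | zero => simp
  | succ n ih =>
    calc c ^ (n + 1) * #F = c * (c ^ n * #F) := by rw [pow_succ', mul_assoc]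
      _ ≤ c * #(F * S ^ n) := mul_le_mul_of_nonneg_left ih hc
      _ ≤ #(F * S ^ (n + 1)) := by simpa only [pow_succ, mul_assoc] using hS (F * S ^ n)

theorem card_add_card_sdiff_le_card_mul {G : Type*} [Group G] [DecidableEq G] {S : Finset G}
    (hone : 1 ∈ S) {g : G} (hg : g ∈ S) (F : Finset G) : #F + #(F \ (F <• g)) ≤ #(F * S) := by
  have htranslate : F <• g ⊆ F * S := fun x hx => by
    obtain ⟨y, hy, rfl⟩ := mem_smul_finset.1 hx
    exact mul_mem_mul hy hg
  calc #F + #(F \ (F <• g)) = #(F ∪ (F <• g)) := by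
        rw [card_sdiff_comm (card_smul_finset _ F).symm, ← card_union_of_disjoint disjoint_sdiff,
          union_sdiff_self_eq_union]
    _ ≤ #(F * S) := card_le_card (union_subset (subset_mul_left F hone) htranslate)

theorem folnerRatio_eq {G : Type u} [Group G] [DecidableEq G] (F : Finset G) (g : G) :
    folnerRatio F g = (#(F \ (F <• g)) : ℝ) / #F := by
  unfold folnerRatio
  congr!

theorem exists_forall_mul_card_le_of_not_folnerCondition {G : Type u} [Group G] [DecidableEq G]
    (hG : ¬ FolnerCondition G) :
    ∃ (S : Finset G) (c : ℝ), 1 < c ∧ ∀ F : Finset G, c * #F ≤ #(F * S) := by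
  simp only [FolnerCondition, not_forall, not_exists, not_and, not_lt] at hG
  obtain ⟨X, ε, hε, hX⟩ := hG
  refine ⟨insert 1 X, 1 + ε, by linarith, fun F => ?_⟩
  rcases F.eq_empty_or_nonempty with rfl | hF
  · simp
  obtain ⟨g, hg, hratio⟩ := hX F hF
  rw [folnerRatio_eq, le_div_iff₀ (by exact_mod_cast hF.card_pos)] at hratio
  have hgrowth : (#F : ℝ) + #(F \ (F <• g)) ≤ #(F * insert 1 X) := by
    exact_mod_cast card_add_card_sdiff_le_card_mul (mem_insert_self 1 X) (mem_insert_of_mem hg) F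
  linarith

theorem folnerCondition_of_not_isParadoxical {G : Type u} [Group G] (hG : ¬ IsParadoxical G) :
    FolnerCondition G := by
  classical
  by_contra hF
  obtain ⟨S, c, hc, hS⟩ := exists_forall_mul_card_le_of_not_folnerCondition hF
  obtain ⟨n, hn⟩ := pow_unbounded_of_one_lt 2 hc
  refine hG (isParadoxical_of_forall_two_mul_card_le (K := S ^ n) fun F => ?_)
  have hdouble : 2 * (#F : ℝ) ≤ #(F * S ^ n) :=
    (mul_le_mul_of_nonneg_right hn.le (Nat.cast_nonneg _)).trans
      (pow_mul_card_le_card_mul_pow (zero_le_one.trans hc.le) hS n F)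
  exact_mod_cast hdouble

end Doubling

section FolnerNet

theorem hasFolnerNet_of_folnerCondition {G : Type u} [Group G] (hG : FolnerCondition G) :
    HasFolnerNet.{u, v} G := by
  classical
  choose F hF hratio using fun i : Finset G × ℕ => hG i.1 (1 / ((i.2 : ℝ) + 1)) (by positivity)
  refine ⟨ULift.{v} (Finset G × ℕ), inferInstance, inferInstance, inferInstance,
    fun i => F i.down, fun i => hF _, fun g => ?_⟩
  have hindex : Tendsto (fun i : ULift.{v} (Finset G × ℕ) => i.down.2) atTop atTop :=
    tendsto_atTop_atTop.2 fun n => ⟨⟨∅, n⟩, fun i hi => hi.2⟩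
  refine squeeze_zero' (.of_forall fun i => by rw [folnerRatio]; positivity) ?_
    (tendsto_one_div_add_atTop_nhds_zero_nat.comp hindex)
  filter_upwards [eventually_ge_atTop ⟨{g}, 0⟩] with i hi
  exact (hratio i.down g (hi.1 (Finset.mem_singleton_self g))).le

end FolnerNet

section Average

variable {α E : Type*} [AddCommGroup E] [Module ℝ E]

/-- The arithmetic mean of `f` over the finite set `F`, equal to `0` if `F` is empty. -/
noncomputable def average (f : α → E) (F : Finset α) : E := (F.card : ℝ)⁻¹ • ∑ h ∈ F, f h

theorem average_prodMk {E' : Type*} [AddCommGroup E'] [Module ℝ E'] (f : α → E) (f' : α → E')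
    (F : Finset α) : average (fun h => (f h, f' h)) F = (average f F, average f' F) := by
  ext <;> simp [average, Prod.fst_sum, Prod.snd_sum]

theorem sum_mem_card_smul {C : Set E} (hC : Convex ℝ C) (hne : C.Nonempty) {f : α → E}
    {F : Finset α} (hf : ∀ h ∈ F, f h ∈ C) : ∑ h ∈ F, f h ∈ (F.card : ℝ) • C := by
  classical
  induction F using Finset.induction_on with
  | empty => simp [Set.zero_smul_set hne]
  | insert a F ha ih =>
    rw [Finset.sum_insert ha, Finset.card_insert_of_notMem ha, add_comm (f a),
      Nat.cast_add_one, hC.add_smul (Nat.cast_nonneg _) zero_le_one, one_smul]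
    exact Set.add_mem_add (ih fun h hh => hf h (Finset.mem_insert_of_mem hh))
      (hf a (Finset.mem_insert_self a F))

theorem average_mem {C : Set E} (hC : Convex ℝ C) {f : α → E} {F : Finset α} (hF : F.Nonempty)
    (hf : ∀ h ∈ F, f h ∈ C) : average f F ∈ C := by
  have hne : C.Nonempty := let ⟨h, hh⟩ := hF; ⟨f h, hf h hh⟩
  have hcard : (F.card : ℝ) ≠ 0 := Nat.cast_ne_zero.2 hF.card_ne_zero
  simpa only [average, inv_smul_smul₀ hcard] using
    Set.smul_mem_smul_set (a := (F.card : ℝ)⁻¹) (sum_mem_card_smul hC hne hf)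

theorem average_translate_sub_mem {G : Type u} [Group G] {C : Set E} (hC : Convex ℝ C)
    {f : G → E} (hf : ∀ h, f h ∈ C) (F : Finset G) (g : G) :
    average (fun h => f (h * g)) F - average f F ∈ folnerRatio F g • (C - C) := by
  classical
  have hne : C.Nonempty := ⟨f 1, hf 1⟩
  have hsum : ∑ h ∈ F, f (h * g) = ∑ h ∈ F <• g, f h := by
    rw [← Finset.image_smul, Finset.sum_image (MulAction.injective _).injOn]
    rfl
  have hcard : ((F <• g) \ F).card = (F \ (F <• g)).card :=
    Finset.card_sdiff_comm (Finset.card_smul_finset _ F)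
  obtain ⟨x, hx, hx'⟩ := sum_mem_card_smul (F := (F <• g) \ F) hC hne fun h _ => hf h
  obtain ⟨y, hy, hy'⟩ := sum_mem_card_smul (F := F \ (F <• g)) hC hne fun h _ => hf h
  have hdiff : ∑ h ∈ F, f (h * g) - ∑ h ∈ F, f h ∈ ((F \ (F <• g)).card : ℝ) • (C - C) := by
    refine ⟨x - y, Set.sub_mem_sub hx hy, ?_⟩
    rw [hcard] at hx'
    rw [hsum, ← Finset.sum_sdiff_sub_sum_sdiff, ← hx', ← hy']
    exact smul_sub _ x y
  rw [average, average, ← smul_sub, folnerRatio_eq, div_eq_inv_mul, mul_smul]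
  exact Set.smul_mem_smul_set hdiff

theorem tendsto_average_translate_sub {G : Type u} [Group G] [TopologicalSpace E]
    [IsTopologicalAddGroup E] [ContinuousSMul ℝ E] {C : Set E} (hC : Convex ℝ C)
    (hC' : IsCompact C) {f : G → E} (hf : ∀ h, f h ∈ C) {I : Type*} {l : Filter I}
    {F : I → Finset G} {g : G} (hF : Tendsto (fun i => folnerRatio (F i) g) l (𝓝 0)) :
    Tendsto (fun i => average (fun h => f (h * g)) (F i) - average f (F i)) l (𝓝 0) := by
  have hbounded : Bornology.IsVonNBounded ℝ (C - C) := by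
    rw [sub_eq_add_neg]
    exact (hC'.add hC'.neg).isVonNBounded ℝ
  exact (hbounded.tendsto_smallSets_nhds.comp hF).of_smallSets <|
    .of_forall fun i => average_translate_sub_mem hC hf (F i) g

end Average

section FixedPoint

variable {E : Type*} [AddCommGroup E] {C : Set E}

theorem exists_forall_smul_eq_of_tendsto_sub [TopologicalSpace E] [IsTopologicalAddGroup E]
    [T2Space E] [CompactSpace C] {H : Type*} [SMul H C] [ContinuousConstSMul H C]
    {I : Type*} {l : Filter I} [l.NeBot] {a : I → C}
    (ha : ∀ h : H, Tendsto (fun i => ((h • a i : C) : E) - a i) l (𝓝 0)) :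
    ∃ c : C, ∀ h : H, h • c = c := by
  have hU : (Ultrafilter.of l : Filter I) ≤ l := Ultrafilter.of_le l
  obtain ⟨c, -, hc⟩ := isCompact_univ.ultrafilter_le_nhds ((Ultrafilter.of l).map a) (by simp)
  refine ⟨c, fun h => Subtype.ext (sub_eq_zero.1 ?_)⟩
  have hcont : Continuous fun x : C => ((h • x : C) : E) - x :=
    (continuous_subtype_val.comp (continuous_const_smul h)).sub continuous_subtype_val
  exact tendsto_nhds_unique ((hcont.tendsto c).comp hc) ((ha h).mono_left hU)

variable [Module ℝ E] {G : Type u} [Group G] [MulAction Gᵐᵒᵖ C]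

theorem IsAffineAction.convex_graph (hG : IsAffineAction G C) (hC : Convex ℝ C) (g : G) :
    Convex ℝ (Set.range fun c : C => ((c : E), ((c <• g : C) : E))) := by
  rintro _ ⟨x, rfl⟩ _ ⟨y, rfl⟩ a b ha hb hab
  exact ⟨⟨a • (x : E) + b • (y : E), hC x.2 y.2 ha hb hab⟩,
    Prod.ext rfl (hG g x y _ a b ha hb hab rfl)⟩

theorem IsAffineAction.coe_smul_eq_average (hG : IsAffineAction G C) (hC : Convex ℝ C) (g : G)
    {α : Type*} {z : α → C} {F : Finset α} (hF : F.Nonempty) {p : C}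
    (hp : (p : E) = average (fun x => (z x : E)) F) :
    ((p <• g : C) : E) = average (fun x => ((z x <• g : C) : E)) F := by
  obtain ⟨c, hc⟩ := average_mem (hG.convex_graph hC g) hF fun x _ => Set.mem_range_self (z x)
  rw [average_prodMk, Prod.mk.injEq] at hc
  obtain rfl : c = p := Subtype.ext (hc.1.trans hp.symm)
  exact hc.2

end FixedPoint

theorem hasFixedPointProperty_of_hasFolnerNet {G : Type u} [Group G] (hG : HasFolnerNet.{u, v} G) :
    HasFixedPointProperty.{u, w} G := by
  obtain ⟨I, _, _, _, F, hF⟩ := hG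
  intro E _ _ _ _ _ _ C ⟨c₀, hc₀⟩ hC hC' _ _ haff
  have : CompactSpace C := isCompact_iff_compactSpace.1 hC'
  let orbit (h : G) : C := (⟨c₀, hc₀⟩ : C) <• h
  let a (i : I) : C := ⟨average (fun h => (orbit h : E)) (F i),
    average_mem hC (hF.nonempty i) fun h _ => (orbit h).2⟩
  have ha (g : G) (i : I) :
      ((a i <• g : C) : E) = average (fun h => (orbit (h * g) : E)) (F i) := by
    simpa only [orbit, MulOpposite.op_mul, mul_smul] using
      haff.coe_smul_eq_average hC g (hF.nonempty i) (p := a i) rfl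
  have hlim (g : G) : Tendsto (fun i => ((a i <• g : C) : E) - a i) atTop (𝓝 0) := by
    simpa only [ha] using
      tendsto_average_translate_sub hC hC' (fun h => (orbit h).2) (hF.tendsto g)
  obtain ⟨c, hc⟩ := exists_forall_smul_eq_of_tendsto_sub (H := Gᵐᵒᵖ) fun h => hlim h.unop
  exact ⟨c, fun g => hc (.op g)⟩

section MeanSpace

variable {Ω : Type u}

theorem Mean.abs_le_norm (m : Mean Ω) (x : EllInfty Ω) : |m.toLinearMap x| ≤ ‖x‖ := by
  have hnorm : m.toLinearMap (‖x‖ • 1) = ‖x‖ := by rw [map_smul, m.map_one, smul_eq_mul, mul_one]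
  have hx (h : Ω) : |x h| ≤ ‖x‖ := lp.norm_apply_le_norm ENNReal.top_ne_zero x h
  have hconst (h : Ω) : (‖x‖ • (1 : EllInfty Ω)) h = ‖x‖ := mul_one _
  have hsub : 0 ≤ m.toLinearMap (‖x‖ • 1 - x) := m.nonneg _ fun h =>
    sub_nonneg.2 ((abs_le.1 (hx h)).2.trans_eq (hconst h).symm)
  have hadd : 0 ≤ m.toLinearMap (‖x‖ • 1 + x) := m.nonneg _ fun h =>
    neg_le_iff_add_nonneg'.1 ((congrArg Neg.neg (hconst h)).trans_le (abs_le.1 (hx h)).1)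
  rw [map_sub, hnorm] at hsub
  rw [map_add, hnorm] at hadd
  exact abs_le.2 ⟨by linarith, by linarith⟩

/-- The mean `x ↦ x a` concentrated at the point `a`. -/
def Mean.dirac (a : Ω) : Mean Ω where
  toLinearMap :=
    { toFun := fun x => x a
      map_add' := fun _ _ => rfl
      map_smul' := fun _ _ => rfl }
  map_one := congrFun lp.infty_coeFn_one a
  nonneg _ hx := hx a

instance [Nonempty Ω] : Nonempty (Mean Ω) := ‹Nonempty Ω›.map Mean.dirac

/-- The topology of pointwise convergence on the bounded functions. -/
noncomputable instance : TopologicalSpace (Mean Ω) :=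
  .induced (fun m => ⇑m.toLinearMap) inferInstance

theorem Mean.isEmbedding_coe :
    IsEmbedding fun (m : Mean Ω) (x : EllInfty Ω) => m.toLinearMap x where
  eq_induced := rfl
  injective := by
    rintro ⟨φ, _, _⟩ ⟨ψ, _, _⟩ h
    obtain rfl : φ = ψ := DFunLike.coe_injective h
    rfl

theorem Mean.range_coe :
    Set.range (fun (m : Mean Ω) (x : EllInfty Ω) => m.toLinearMap x) =
      Set.range ((↑) : (EllInfty Ω →ₗ[ℝ] ℝ) → EllInfty Ω → ℝ) ∩ {f | f 1 = 1} ∩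
        {f | ∀ x : EllInfty Ω, (∀ h, 0 ≤ x h) → 0 ≤ f x} := by
  ext f
  constructor
  · rintro ⟨m, rfl⟩
    exact ⟨⟨⟨_, rfl⟩, m.map_one⟩, m.nonneg⟩
  · rintro ⟨⟨⟨φ, rfl⟩, hone⟩, hpos⟩
    exact ⟨⟨φ, hone, hpos⟩, rfl⟩

theorem Mean.isClosed_range_coe :
    IsClosed (Set.range fun (m : Mean Ω) (x : EllInfty Ω) => m.toLinearMap x) := by
  rw [Mean.range_coe]
  refine ((LinearMap.isClosed_range_coe _ _ _).inter
    (isClosed_eq (continuous_apply _) continuous_const)).inter ?_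
  simp only [Set.ofPred_forall]
  exact isClosed_iInter fun x => isClosed_iInter fun _ =>
    isClosed_le continuous_const (continuous_apply x)

instance : CompactSpace (Mean Ω) := by
  rw [← isCompact_univ_iff, Mean.isEmbedding_coe.isCompact_iff, Set.image_univ]
  exact (isCompact_univ_pi fun x => isCompact_Icc (a := -‖x‖) (b := ‖x‖)).of_isClosed_subset
    Mean.isClosed_range_coe (Set.range_subset_iff.2 fun m x _ => abs_le.1 (m.abs_le_norm x))

theorem Mean.convex_range_coe :
    Convex ℝ (Set.range fun (m : Mean Ω) (x : EllInfty Ω) => m.toLinearMap x) := by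
  rintro _ ⟨m, rfl⟩ _ ⟨m', rfl⟩ a b ha hb hab
  refine ⟨⟨a • m.toLinearMap + b • m'.toLinearMap, ?_, fun x hx => ?_⟩, rfl⟩
  · simp [m.map_one, m'.map_one, hab]
  · exact add_nonneg (mul_nonneg ha (m.nonneg x hx)) (mul_nonneg hb (m'.nonneg x hx))

end MeanSpace

section MeanAction

variable {G : Type u} [Group G]

theorem EllInfty.translate_one (x : EllInfty G) : x.translate 1 = x := by
  ext h
  simp [EllInfty.translate]

theorem EllInfty.translate_translate (x : EllInfty G) (g h : G) :
    (x.translate g).translate h = x.translate (g * h) := by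
  ext k
  simp [EllInfty.translate, mul_assoc]

/-- The right action of `G` on its means, given by `(m g) x = m (x ^ g⁻¹)`. -/
noncomputable instance : MulAction Gᵐᵒᵖ (Mean G) where
  smul g m :=
    { toLinearMap :=
        { toFun := fun x => m.toLinearMap (x.translate g.unop⁻¹)
          map_add' := fun x y => m.toLinearMap.map_add (x.translate _) (y.translate _)
          map_smul' := fun c x => m.toLinearMap.map_smul c (x.translate _) }
      map_one := m.map_one
      nonneg := fun x hx => m.nonneg _ fun h => hx _ }
  one_smul m := Mean.isEmbedding_coe.injective <| funext fun x =>
    congrArg m.toLinearMap ((congrArg x.translate inv_one).trans x.translate_one)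
  mul_smul _ _ m := Mean.isEmbedding_coe.injective <| funext fun x =>
    congrArg m.toLinearMap <| by
      rw [EllInfty.translate_translate, MulOpposite.unop_mul, mul_inv_rev]

theorem Mean.smul_apply (m : Mean G) (g : G) (x : EllInfty G) :
    (m <• g).toLinearMap x = m.toLinearMap (x.translate g⁻¹) := rfl

instance : ContinuousConstSMul Gᵐᵒᵖ (Mean G) where
  continuous_const_smul g := Mean.isEmbedding_coe.continuous_iff.2 <| continuous_pi fun x =>
    (continuous_apply (x.translate g.unop⁻¹)).comp Mean.isEmbedding_coe.continuous

theorem HasFixedPointProperty.exists_fixed_of_isEmbedding (hG : HasFixedPointProperty.{u, w} G)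
    {K : Type*} [TopologicalSpace K] [CompactSpace K] [Nonempty K] [MulAction Gᵐᵒᵖ K]
    [ContinuousConstSMul Gᵐᵒᵖ K] {E : Type (max u w)} [AddCommGroup E] [Module ℝ E]
    [TopologicalSpace E] [IsTopologicalAddGroup E] [ContinuousSMul ℝ E] [T2Space E] {ι : K → E}
    (hι : IsEmbedding ι) (hconvex : Convex ℝ (Set.range ι))
    (haffine : ∀ (g : G) (x y p : K) (a b : ℝ), 0 ≤ a → 0 ≤ b → a + b = 1 →
      ι p = a • ι x + b • ι y → ι (p <• g) = a • ι (x <• g) + b • ι (y <• g)) :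
    ∃ k : K, ∀ g : G, k <• g = k := by
  let e : K ≃ₜ Set.range ι := hι.toHomeomorph
  let _ : MulAction Gᵐᵒᵖ (Set.range ι) := e.symm.toEquiv.mulAction Gᵐᵒᵖ
  have hsmul (g : G) (k : K) : e k <• g = e (k <• g) :=
    congrArg (fun k' => e (k' <• g)) (e.symm_apply_apply k)
  have : ContinuousConstSMul Gᵐᵒᵖ (Set.range ι) :=
    ⟨fun g => e.continuous.comp ((continuous_const_smul g).comp e.symm.continuous)⟩
  have haction : IsAffineAction G (Set.range ι) := by
    intro g x y p a b ha hb hab hp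
    obtain ⟨x, rfl⟩ := e.surjective x
    obtain ⟨y, rfl⟩ := e.surjective y
    obtain ⟨p, rfl⟩ := e.surjective p
    simp only [hsmul]
    exact haffine g x y p a b ha hb hab hp
  obtain ⟨c, hc⟩ := hG E (Set.range ι) (Set.range_nonempty ι) hconvex
    (isCompact_range hι.continuous) haction
  obtain ⟨k, rfl⟩ := e.surjective c
  exact ⟨k, fun g => e.injective ((hsmul g k).symm.trans (hc g))⟩

theorem exists_isRightInvariant_mean_of_hasFixedPointProperty
    (hG : HasFixedPointProperty.{u, w} G) : ∃ m : Mean G, m.IsRightInvariant := by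
  let lift : (EllInfty G → ℝ) →ₗ[ℝ] (ULift.{w} (EllInfty G) → ℝ) :=
    LinearMap.funLeft ℝ ℝ ULift.down
  have hlift : IsEmbedding lift := .of_leftInverse (f := fun p x => p ⟨x⟩) (fun _ => rfl)
    (by fun_prop) (continuous_pi fun x => continuous_apply x.down)
  obtain ⟨m, hm⟩ := hG.exists_fixed_of_isEmbedding (hlift.comp Mean.isEmbedding_coe)
    (by rw [Set.range_comp]; exact Mean.convex_range_coe.linear_image lift)
    fun g x y p a b _ _ _ hp => funext fun z => congrFun hp ⟨z.down.translate g⁻¹⟩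
  refine ⟨m, fun x g => ?_⟩
  rw [← inv_inv g, ← m.smul_apply, hm]

end MeanAction

section PushforwardOfMean

variable {α : Type u} {Ω : Type*} [TopologicalSpace Ω]

/-- The bounded function `f ∘ φ`, as a linear function of `f`. -/
def pullback (φ : α → Ω) : C_c(Ω, ℝ) →ₗ[ℝ] EllInfty α where
  toFun f := ⟨f ∘ φ, memℓp_infty <| by
    obtain ⟨R, hR⟩ := f.hasCompactSupport.exists_bound_of_continuous f.continuous
    exact ⟨R, by rintro _ ⟨a, rfl⟩; exact hR (φ a)⟩⟩
  map_add' _ _ := rfl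
  map_smul' _ _ := rfl

variable [T2Space Ω] [LocallyCompactSpace Ω] [MeasurableSpace Ω] [BorelSpace Ω]

/-- The regular Borel measure representing the functional `f ↦ m (f ∘ φ)`. -/
noncomputable def Mean.pushforward (m : Mean α) (φ : α → Ω) : Measure Ω :=
  RealRMK.rieszMeasure <| PositiveLinearMap.mk₀ (m.toLinearMap ∘ₗ pullback φ) fun _ hf =>
    m.nonneg _ fun a => hf (φ a)

instance (m : Mean α) (φ : α → Ω) : (m.pushforward φ).Regular :=
  inferInstanceAs (RealRMK.rieszMeasure _).Regular

theorem Mean.integral_pushforward (m : Mean α) (φ : α → Ω) (f : C_c(Ω, ℝ)) :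
    ∫ ω, f ω ∂m.pushforward φ = m.toLinearMap (pullback φ f) :=
  RealRMK.integral_rieszMeasure _ f

theorem Mean.map_pushforward_eq_self (m : Mean α) (φ : α → Ω) (θ : Ω ≃ₜ Ω)
    (hθ : ∀ f : C_c(Ω, ℝ), m.toLinearMap (pullback (θ ∘ φ) f) = m.toLinearMap (pullback φ f)) :
    (m.pushforward φ).map θ = m.pushforward φ := by
  have : ((m.pushforward φ).map θ).Regular := .map θ
  refine Measure.ext_of_integral_eq_on_compactlySupported fun f => ?_
  rw [θ.measurableEmbedding.integral_map, m.integral_pushforward, ← hθ]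
  exact m.integral_pushforward φ
    ⟨f.toContinuousMap.comp θ, f.hasCompactSupport.comp_homeomorph θ⟩

instance [CompactSpace Ω] (m : Mean α) (φ : α → Ω) : IsProbabilityMeasure (m.pushforward φ) := by
  have hone : ∫ _, (1 : ℝ) ∂m.pushforward φ = 1 :=
    (m.integral_pushforward φ ⟨1, .of_compactSpace _⟩).trans m.map_one
  simpa [isProbabilityMeasure_iff_real] using hone

end PushforwardOfMean

theorem hasInvariantMeasureProperty_of_mean {G : Type u} [Group G] {m : Mean G}
    (hm : m.IsRightInvariant) : HasInvariantMeasureProperty.{u, z} G := by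
  intro Ω _ _ _ ⟨ω⟩ _ _ _ _
  let orbit (h : G) : Ω := ω <• h
  have horbit (g : G) (f : C_c(Ω, ℝ)) : pullback (Homeomorph.smul (MulOpposite.op g⁻¹) ∘ orbit) f =
      (pullback orbit f).translate g := by
    ext h
    exact congrArg f (mul_smul (MulOpposite.op g⁻¹) (MulOpposite.op h) ω).symm
  refine ⟨m.pushforward orbit, inferInstance, fun g A hA => ?_⟩
  have hmap := m.map_pushforward_eq_self orbit (Homeomorph.smul (MulOpposite.op g⁻¹))
    fun f => by rw [horbit, hm]
  calc m.pushforward orbit (A <• g)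
      = (m.pushforward orbit).map (Homeomorph.smul (MulOpposite.op g⁻¹)) A := by
        rw [Measure.map_apply (Homeomorph.continuous _).measurable hA]
        exact congrArg _ (Set.preimage_smul_inv (MulOpposite.op g) A).symm
    _ = m.pushforward orbit A := by rw [hmap]

section Ultrafilters

theorem HasInvariantMeasureProperty.exists_invariant_measure {G : Type u} [Group G]
    (hG : HasInvariantMeasureProperty.{u, z} G) (Ω : Type u) [TopologicalSpace Ω] [CompactSpace Ω]
    [T2Space Ω] [Nonempty Ω] [MeasurableSpace Ω] [BorelSpace Ω] [MulAction Gᵐᵒᵖ Ω]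
    [ContinuousConstSMul Gᵐᵒᵖ Ω] :
    ∃ μ : Measure Ω, IsProbabilityMeasure μ ∧
      ∀ (g : G) (A : Set Ω), MeasurableSet A → μ (A <• g) = μ A := by
  have : ContinuousConstSMul Gᵐᵒᵖ (ULift.{z} Ω) :=
    ⟨fun g => continuous_uliftUp.comp (continuous_uliftDown.const_smul g)⟩
  obtain ⟨μ, _, hμ⟩ := hG (ULift.{z} Ω)
  have hdown : Measurable (ULift.down : ULift.{z} Ω → Ω) := measurable_down
  refine ⟨μ.map ULift.down, Measure.isProbabilityMeasure_map hdown.aemeasurable, fun g A hA => ?_⟩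
  rw [Measure.map_apply hdown (hA.const_smul _), Measure.map_apply hdown hA, ← hμ g _ (hdown hA)]
  congr 1
  ext ω
  simp only [Set.mem_preimage, Set.mem_smul_set_iff_inv_smul_mem]
  rfl

variable {M H α : Type*}

/-- The action on the ultrafilters on `α`, i.e. on the Stone–Čech compactification of the discrete
space `α`, by pushforward. -/
instance [Monoid M] [MulAction M α] : MulAction M (Ultrafilter α) where
  smul a U := U.map (a • ·)
  one_smul U := by
    change U.map _ = U
    simp
  mul_smul a b U := by
    change U.map _ = (U.map _).map _
    rw [Ultrafilter.map_map]
    congr 1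
    funext x
    exact mul_smul a b x

theorem mem_smul_ultrafilter [Monoid M] [MulAction M α] {a : M} {U : Ultrafilter α} {X : Set α} :
    X ∈ a • U ↔ (a • ·) ⁻¹' X ∈ U := Iff.rfl

instance [Monoid M] [MulAction M α] : ContinuousConstSMul M (Ultrafilter α) where
  continuous_const_smul a := by
    refine ultrafilterBasis_is_basis.continuous_iff.2 ?_
    rintro _ ⟨X, rfl⟩
    exact ultrafilter_isOpen_basic ((a • ·) ⁻¹' X)

theorem setOf_smul_mem_ultrafilter [Group H] [MulAction H α] (a : H) (X : Set α) :
    {U : Ultrafilter α | a • X ∈ U} = a • {U : Ultrafilter α | X ∈ U} := by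
  ext U
  rw [Set.mem_smul_set_iff_inv_smul_mem]
  change _ ↔ X ∈ a⁻¹ • U
  rw [mem_smul_ultrafilter, Set.preimage_smul_inv]
  exact Iff.rfl

/-- The finitely additive measure `X ↦ ν {U | X ∈ U}`: it identifies a subset of `α` with the
corresponding clopen set of ultrafilters. -/
noncomputable def finAddProbMeasureOfUltrafilter {α : Type u} [MeasurableSpace (Ultrafilter α)]
    [OpensMeasurableSpace (Ultrafilter α)] (ν : Measure (Ultrafilter α)) [IsProbabilityMeasure ν] :
    FinAddProbMeasure α where
  toFun X := ν.real {U | X ∈ U}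
  mem_Icc X := ⟨measureReal_nonneg, measureReal_le_one⟩
  univ := (congrArg ν.real (Set.eq_univ_of_forall fun _ => univ_mem)).trans probReal_univ
  union X Y hXY := by
    rw [← measureReal_union _ (ultrafilter_isOpen_basic Y).measurableSet]
    · exact congrArg ν.real (Set.ext fun U => Ultrafilter.union_mem_iff)
    · exact Set.disjoint_left.2 fun U hX hY => U.empty_notMem (hXY.inter_eq ▸ inter_mem hX hY)

theorem exists_isRightInvariant_finAddProbMeasure_of_hasInvariantMeasureProperty
    {G : Type u} [Group G] (hG : HasInvariantMeasureProperty.{u, z} G) :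
    ∃ μ : FinAddProbMeasure G, μ.IsRightInvariant := by
  let _ : MeasurableSpace (Ultrafilter G) := borel _
  have : BorelSpace (Ultrafilter G) := ⟨rfl⟩
  obtain ⟨ν, _, hν⟩ := hG.exists_invariant_measure (Ultrafilter G)
  refine ⟨finAddProbMeasureOfUltrafilter ν, fun X g => ?_⟩
  have hX : MeasurableSet {U : Ultrafilter G | X ∈ U} := (ultrafilter_isOpen_basic X).measurableSet
  change ν.real {U | X <• g ∈ U} = ν.real {U | X ∈ U}
  rw [setOf_smul_mem_ultrafilter, measureReal_def, hν g _ hX, measureReal_def]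

end Ultrafilters

end AmenableGroup

theorem mainTheorem1 (G : Type u) [Group G] :
    List.TFAE [
      ∃ μ : AmenableGroup.FinAddProbMeasure G, μ.IsRightInvariant,
      ∃ m : AmenableGroup.Mean G, m.IsRightInvariant,
      AmenableGroup.FolnerCondition G,
      AmenableGroup.HasFolnerNet.{u, v} G,
      ¬ AmenableGroup.IsParadoxical G,
      AmenableGroup.HasFixedPointProperty.{u, w} G,
      AmenableGroup.HasInvariantMeasureProperty.{u, z} G] := by
  tfae_have 1 → 5 := fun ⟨μ, hμ⟩ => μ.not_isParadoxicalAction hμ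
  tfae_have 5 → 3 := AmenableGroup.folnerCondition_of_not_isParadoxical
  tfae_have 3 → 4 := AmenableGroup.hasFolnerNet_of_folnerCondition
  tfae_have 4 → 6 := AmenableGroup.hasFixedPointProperty_of_hasFolnerNet
  tfae_have 6 → 2 := AmenableGroup.exists_isRightInvariant_mean_of_hasFixedPointProperty
  tfae_have 2 → 7 := fun ⟨_, hm⟩ => AmenableGroup.hasInvariantMeasureProperty_of_mean hm
  tfae_have 7 → 1 :=
    AmenableGroup.exists_isRightInvariant_finAddProbMeasure_of_hasInvariantMeasureProperty
  tfae_finish
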